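/- Let $\mathrm{FI}$ be the category whose objects are the natural numbers $a\in\mathbb N$ and whose morphisms $a\to b$ are the injective maps $\{1,\dots,a\}\to\{1,\dots,b\}$; let $m\ge 1$ and let $\mathrm{FI}^m$ be the product of $m$ copies of $\mathrm{FI}$. For a commutative ring $k$, an $\mathrm{FI}^m$-module over $k$ is a functor $V$ from $\mathrm{FI}^m$ to $k$-modules; write $V_{\mathbf n}$ for its value at $\mathbf n\in\mathbb N^m$ and put $|\mathbf n|=n_1+\cdots+n_m$. The following notions are used. * For $\mathbf n\in\mathbb N^m$, $M(\mathbf n)$ is the $\mathrm{FI}^m$-module with $M(\mathbf n)_{\mathbf a}$ the free $k$-module on the set of morphisms $\mathbf n\to\mathbf a$, on which morphisms act by composition. A module is free if it is isomorphic to a direct sum of modules $M(\mathbf n)$. * $H_0(V)=V/\widetilde V$, where $\widetilde V_{\mathbf n}\subseteq V_{\mathbf n}$ is the $k$-submodule generated by all $f_*(v)$ with $f:\mathbf a\to\mathbf n$, $\mathbf a\ne\mathbf n$, $v\in V_{\mathbf a}$; and $H_i$ is the $i$-th left derived functor of $H_0$ on the category of $\mathrm{FI}^m$-modules. $V$ is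 homology acyclic if $H_i(V)=0$ for all $i\ge 1$. * $\deg V=\sup\{|\mathbf n| : V_{\mathbf n}\ne 0\}$, with $\deg 0=-1$. $V$ is generated in degree $\le d$ if $\deg H_0(V)\le d$. $V$ is generated in degree $\le d$ and related in degree $\le r$ if there is a short exact sequence $0\to U\to P\to V\to 0$ with $P$ free and generated in degree $\le d$, and $U$ generated in degree $\le r$. * For $1\le i\le m$, $\Sigma_i V$ is the pullback of $V$ along the functor $\iota_i:\mathrm{FI}^m\to\mathrm{FI}^m$ that sends $\mathbf a$ to $\mathbf a+\mathbf e_i$ and $(f_1,\dots,f_m)$ to $(g_1,\dots,g_m)$, where $g_j=f_j$ for $j\ne i$, $g_i(1)=1$ and $g_i(x+1)=f_i(x)+1$. **Theorem.** Let $m\ge 1$ and $d,r\ge -1$ be integers, let $k$ be a commutative ring, and let $V$ be an $\mathrm{FI}^m$-module over $k$ (not necessarily finitely generated) that is generated in degree $\le d$ and related in degree $\le r$. Then for every integer $s\ge\max(0,d+r)$, the $\mathrm{FI}^m$-module $\Sigma_1^s\Sigma_2^s\cdots\Sigma_m^s V$ is homology acyclic. -/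

import Mathlib

open CategoryTheory CategoryTheory.Limits

universe u

namespace FIModule

noncomputable section

/-- The skeleton of the category of finite sets and injective maps: the objects are the natural
numbers `a` (written `⟨a⟩`), where `a` stands for the finite set `Fin a`. -/
@[ext]
structure FI : Type where
  /-- The natural number. -/
  card : ℕ

instance : SmallCategory FI where
  Hom a b := Fin a.card ↪ Fin b.card
  id a := Function.Embedding.refl _
  comp f g := f.trans g

/-- The product of `m` copies of `FI`, with its product category structure. -/
abbrev FIPow (m : ℕ) : Type := Fin m → FI

/-- `FI^m`-modules over `k`: functors from `FI^m` to `k`-modules, and natural transformations. -/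
abbrev FIMod (k : Type u) [CommRing k] (m : ℕ) : Type (u + 1) := FIPow m ⥤ ModuleCat.{u} k

/-- `|n| = n_1 + ⋯ + n_m`. -/
def total {m : ℕ} (n : FIPow m) : ℕ := ∑ j, (n j).card

variable {k : Type u} [CommRing k] {m : ℕ}

/-! ### Principal projective and free modules -/

variable (k) in
/-- The principal projective module `M(n)`: `M(n)_a` is the free `k`-module on the set of
morphisms `n ⟶ a`, and `g : a ⟶ b` acts by composition on basis elements. -/
def principalProjective (n : FIPow m) : FIMod k m where
  obj a := ModuleCat.of k ((n ⟶ a) →₀ k)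
  map g := ModuleCat.ofHom (Finsupp.lmapDomain k k fun f => f ≫ g)
  map_id a := by
    ext : 1
    refine Finsupp.lhom_ext fun f c => ?_
    simp
  map_comp g h := by
    ext : 1
    refine Finsupp.lhom_ext fun f c => ?_
    simp

/-- A module is free if it is isomorphic to a direct sum of principal projective modules. -/
def IsFree (P : FIMod k m) : Prop :=
  ∃ (J : Type u) (n : J → FIPow m), Nonempty (P ≅ ∐ fun j => principalProjective k (n j))

/-- The homomorphism `M(n) ⟶ V` that sends the identity of `n` to `v`. -/
def fromPrincipal (V : FIMod k m) (n : FIPow m) (v : V.obj n) : principalProjective k n ⟶ V where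
  app a := ModuleCat.ofHom (Finsupp.linearCombination k fun f : n ⟶ a => V.map f v)
  naturality a b g := by
    ext : 1
    refine Finsupp.lhom_ext fun f c => ?_
    simp [principalProjective]

/-- The basis element of `M(n)_a` given by a morphism `f : n ⟶ a`. -/
def basisElt {n a : FIPow m} (f : n ⟶ a) : (principalProjective k n).obj a :=
  (Finsupp.single f 1 : (n ⟶ a) →₀ k)

lemma map_basisElt {n a b : FIPow m} (f : n ⟶ a) (g : a ⟶ b) :
    (principalProjective k n).map g (basisElt f) = basisElt (f ≫ g) :=
  Finsupp.mapDomain_single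

lemma fromPrincipal_apply (V : FIMod k m) (n : FIPow m) (v : V.obj n) :
    (fromPrincipal V n v).app n (basisElt (𝟙 n)) = v := by
  change Finsupp.linearCombination k (fun f : n ⟶ n => V.map f v) (Finsupp.single (𝟙 n) 1) = v
  simp

lemma principal_hom_ext {V : FIMod k m} {n : FIPow m} (α β : principalProjective k n ⟶ V)
    (h : α.app n (basisElt (𝟙 n)) = β.app n (basisElt (𝟙 n))) : α = β := by
  ext a : 3
  refine Finsupp.lhom_ext' fun f => LinearMap.ext_ring ?_
  have key : ∀ γ : principalProjective k n ⟶ V,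
      γ.app a (basisElt f) = V.map f (γ.app n (basisElt (𝟙 n))) := by
    intro γ
    rw [← NatTrans.naturality_apply, map_basisElt, Category.id_comp]
  exact (key α).trans ((congrArg _ h).trans (key β).symm)

instance (n : FIPow m) : Projective (principalProjective k n) where
  factors {E X} f e he := by
    have hs : Function.Surjective (e.app n) :=
      (ModuleCat.epi_iff_surjective _).1 inferInstance
    obtain ⟨v, hv⟩ := hs (f.app n (basisElt (𝟙 n)))
    refine ⟨fromPrincipal E n v, principal_hom_ext _ _ ?_⟩
    rw [NatTrans.comp_app, ModuleCat.comp_apply, fromPrincipal_apply, hv]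

/-- There are enough projectives, so that left derived functors exist. -/
instance : EnoughProjectives (FIMod k m) where
  presentation V := ⟨
    { p := ∐ fun x : (Σ n : FIPow m, V.obj n) => principalProjective k x.1
      f := Sigma.desc fun x => fromPrincipal V x.1 x.2
      epi := by
        rw [NatTrans.epi_iff_epi_app]
        intro n
        rw [ModuleCat.epi_iff_surjective]
        intro v
        refine ⟨(Sigma.ι (fun x : (Σ n : FIPow m, V.obj n) => principalProjective k x.1)
          ⟨n, v⟩).app n (basisElt (𝟙 n)), ?_⟩
        rw [← ModuleCat.comp_apply, ← NatTrans.comp_app, Sigma.ι_desc]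
        exact fromPrincipal_apply V n v }⟩

/-! ### Homology -/

/-- The submodule `Ṽ_n` of `V_n` generated by all `f_*(v)` with `f : a ⟶ n`, `a ≠ n`, `v ∈ V_a`. -/
def decomposable (V : FIMod k m) (n : FIPow m) : Submodule k (V.obj n) :=
  Submodule.span k {x | ∃ (a : FIPow m) (_ : a ≠ n) (f : a ⟶ n) (v : V.obj a), V.map f v = x}

lemma eq_of_hom_of_hom {a b : FIPow m} (f : a ⟶ b) (g : b ⟶ a) : a = b := by
  funext j
  have h₁ : (a j).card ≤ (b j).card := by
    simpa using Fintype.card_le_of_embedding (show Fin (a j).card ↪ Fin (b j).card from f j)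
  have h₂ : (b j).card ≤ (a j).card := by
    simpa using Fintype.card_le_of_embedding (show Fin (b j).card ↪ Fin (a j).card from g j)
  exact FI.ext (le_antisymm h₁ h₂)

lemma decomposable_le_comap_map (V : FIMod k m) {n p : FIPow m} (g : n ⟶ p) :
    decomposable V n ≤ (decomposable V p).comap (V.map g).hom := by
  refine Submodule.span_le.2 ?_
  rintro _ ⟨a, ha, f, v, rfl⟩
  refine Submodule.subset_span ⟨a, ?_, f ≫ g, v, by simp⟩
  rintro rfl
  exact ha (eq_of_hom_of_hom f g)

lemma decomposable_le_comap_app {V W : FIMod k m} (α : V ⟶ W) (n : FIPow m) :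
    decomposable V n ≤ (decomposable W n).comap (α.app n).hom := by
  refine Submodule.span_le.2 ?_
  rintro _ ⟨a, ha, f, v, rfl⟩
  exact Submodule.subset_span ⟨a, ha, f, α.app a v, (NatTrans.naturality_apply α f v).symm⟩

/-- The functor `H_0 : V ↦ V / Ṽ`. -/
def H0 (k : Type u) [CommRing k] (m : ℕ) : FIMod k m ⥤ FIMod k m where
  obj V :=
    { obj n := ModuleCat.of k (V.obj n ⧸ decomposable V n)
      map g := ModuleCat.ofHom
        (Submodule.mapQ _ _ (V.map g).hom (decomposable_le_comap_map V g))
      map_id n := by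
        ext : 1
        refine Submodule.linearMap_qext _ ?_
        ext x
        simp
      map_comp g h := by
        ext : 1
        refine Submodule.linearMap_qext _ ?_
        ext x
        simp }
  map α :=
    { app n := ModuleCat.ofHom
        (Submodule.mapQ _ _ (α.app n).hom (decomposable_le_comap_app α n))
      naturality n p g := by
        ext : 1
        refine Submodule.linearMap_qext _ ?_
        ext x
        simp [NatTrans.naturality_apply] }
  map_id V := by
    ext n : 3
    refine Submodule.linearMap_qext _ ?_
    ext x
    simp
  map_comp α β := by
    ext n : 3
    refine Submodule.linearMap_qext _ ?_
    ext x
    simp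

instance : (H0 k m).Additive where
  map_add {V W α β} := by
    ext n : 3
    refine Submodule.linearMap_qext _ ?_
    ext x
    rfl

/-- `H_i`, the `i`-th left derived functor of `H_0`. -/
def H (k : Type u) [CommRing k] (m i : ℕ) : FIMod k m ⥤ FIMod k m := (H0 k m).leftDerived i

/-- `V` is homology acyclic if `H_i(V) = 0` for all `i ≥ 1`. -/
def HomologyAcyclic (V : FIMod k m) : Prop := ∀ i : ℕ, 1 ≤ i → IsZero ((H k m i).obj V)

/-! ### Degrees of generation and relation -/

/-- The degree of `V`: the supremum of all `|n|` with `V_n ≠ 0`, and `-1` if `V = 0`.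
(Since `|n| ≥ 0`, taking the maximum with `-1` changes the supremum only if `V = 0`.) -/
def degree (V : FIMod k m) : WithBot (WithTop ℤ) :=
  ((-1 : ℤ) : WithTop ℤ) ⊔
    ⨆ (n : FIPow m) (_ : Nontrivial (V.obj n)), (((total n : ℤ) : WithTop ℤ) : WithBot (WithTop ℤ))

lemma degree_le_iff (V : FIMod k m) (d : ℤ) :
    degree V ≤ ((d : WithTop ℤ) : WithBot (WithTop ℤ)) ↔
      -1 ≤ d ∧ ∀ n : FIPow m, Nontrivial (V.obj n) → (total n : ℤ) ≤ d := by
  simp only [degree, sup_le_iff, iSup_le_iff, WithBot.coe_le_coe, WithTop.coe_le_coe]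

/-- `V` is generated in degree `≤ d` if `t_0(V) = deg H_0(V) ≤ d`. -/
def GeneratedInDegree (V : FIMod k m) (d : ℤ) : Prop :=
  degree ((H0 k m).obj V) ≤ ((d : WithTop ℤ) : WithBot (WithTop ℤ))

/-- `V` is generated in degree `≤ d` and related in degree `≤ r` if there is a short exact sequence
`0 → U → P → V → 0` with `P` free and generated in degree `≤ d`, and `U` generated in degree
`≤ r`. -/
def GeneratedRelatedInDegree (V : FIMod k m) (d r : ℤ) : Prop :=
  ∃ (U P : FIMod k m) (f : U ⟶ P) (g : P ⟶ V) (w : f ≫ g = 0),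
    (ShortComplex.mk f g w).ShortExact ∧
      IsFree P ∧ GeneratedInDegree P d ∧ GeneratedInDegree U r

/-! ### Shift functors -/

/-- For an injection `f : Fin a → Fin b`, the injection `Fin (a + 1) → Fin (b + 1)` that fixes `0`
and sends `x + 1` to `f x + 1`. -/
def extendEmb {a b : ℕ} (f : Fin a ↪ Fin b) : Fin (a + 1) ↪ Fin (b + 1) where
  toFun := Fin.cases 0 fun x => (f x).succ
  inj' x y h := by
    induction x using Fin.cases <;> induction y using Fin.cases <;>
      simp_all [Fin.succ_ne_zero, (Fin.succ_ne_zero _).symm]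

/-- The functor `ι : FI ⥤ FI` with `a ↦ a + 1` that adjoins a fixed point at the beginning. -/
def iota : FI ⥤ FI where
  obj a := ⟨a.card + 1⟩
  map {a b} f := extendEmb (a := a.card) (b := b.card) f
  map_id a := by
    refine Function.Embedding.ext fun x => ?_
    induction x using Fin.cases <;> rfl
  map_comp f g := by
    refine Function.Embedding.ext fun x => ?_
    induction x using Fin.cases <;> rfl

/-- The functor `ι_i : FI^m ⥤ FI^m` that applies `ι` in the `i`-th coordinate and the identity in
the others. -/
def iotaAt (i : Fin m) : FIPow m ⥤ FIPow m :=
  Functor.pi fun j => if j = i then iota else 𝟭 FI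

lemma iotaAt_obj_card (i : Fin m) (a : FIPow m) (j : Fin m) :
    ((iotaAt i).obj a j).card = (a j).card + (Pi.single i 1 : Fin m → ℕ) j := by
  by_cases h : j = i
  · subst h; simp [iotaAt, iota]
  · simp [iotaAt, h]

/-- The `i`-th shift functor `Σ_i`: pullback along `ι_i`. -/
def shift (k : Type u) [CommRing k] (i : Fin m) : FIMod k m ⥤ FIMod k m :=
  (Functor.whiskeringLeft (FIPow m) (FIPow m) (ModuleCat.{u} k)).obj (iotaAt i)

/-- `Σ_1^s Σ_2^s ⋯ Σ_m^s V`. -/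
def multiShift (s : ℕ) (V : FIMod k m) : FIMod k m :=
  (List.finRange m).foldr (fun i W => (shift k i).obj^[s] W) V

end

end FIModule

/-!
The derivative `D_c V` in the direction `c` is the cokernel of the canonical map `V ⟶ Σ_c V`. Call
`V` torsion free in the direction `c` if this map is injective. Three facts carry the proof.

**Derivatives compute homology.** By `toDeriv_mem_decomposable_iff`, `H_0(V)` at `n + e_c` is
`H_0(D_c V)` at `n`, so that `H_0(V)_n` is the value at `0` of the derivative of `V` taken `n_j` times
in each direction `j`. The functor `D_c` is right exact, and it preserves short exact sequences
`0 ⟶ A ⟶ B ⟶ C ⟶ 0` with `C` torsion free in the direction `c`. Hence `H_0` is exact on short exact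
sequences whose third term is torsion free together with all its iterated derivatives. This class of
modules contains the projective modules, because for these `V ⟶ Σ_c V` is a split monomorphism,
a property that passes to derivatives (`ShiftSplit`). It is also closed under kernels of
surjections. So all syzygies of such a module lie in the class, and the module is homology acyclic
(`homologyAcyclic_of_derivTorsionFree`).

**The torsion of a presented module is bounded.** Let `0 ⟶ U ⟶ P ⟶ V ⟶ 0` be a presentation with
generators in degrees `< p` and relations in degrees `< q`. In one direction `c` this gives
`D_c^p P = 0` and `D_c^q U = 0`. By `torsion_bound`, `V_n ⟶ V_{n + e_c}` is injective as soon as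
`n_c + 2 ≥ p + q`. The proof is an induction on `p`. The kernel `Y` of `D_c U ⟶ D_c P` consists of
the torsion of `V`, so that morphisms which adjoin a point in the direction `c` act on it by zero,
and its quotient `I = D_c U / Y` is the module of relations of `D_c V`. Induction bounds the degrees
of the relations of `I` (`RelationBound`), hence those of the generators of `Y`, and `Y` vanishes above
the degrees of its generators. Next, `D_c U` is an extension of `I` by `Y`, and a bound for the
relations of `D_c U` gives one for those of the torsion free module `U`.

**Derivatives and shifts.** Each derivative of `V` has a presentation within the same bounds, so that
`torsion_bound` applies to all iterated derivatives of `V`. Shifts commute with derivatives up to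
the exchange of two adjoined points (`derivShift`). After `s` shifts in each direction, where
`s + 2 ≥ p + q = (d + 1) + (r + 1)`, all iterated derivatives are therefore torsion free everywhere.
-/

namespace FIModule

/-! ### The combinatorics of adjoining a point -/

/-- The embedding `x ↦ x + 1` of `Fin a` into `Fin (a + 1)`. -/
def addPoint : 𝟭 FI ⟶ iota where
  app a := Fin.succEmb a.card
  naturality _ _ _ := rfl

lemma swap_extendEmb_extendEmb {a b : ℕ} (f : Fin a ↪ Fin b) (x : Fin (a + 2)) :
    Equiv.swap (0 : Fin (b + 2)) 1 (extendEmb (extendEmb f) x) =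
      extendEmb (extendEmb f) (Equiv.swap (0 : Fin (a + 2)) 1 x) :=
  ((extendEmb (extendEmb f)).injective.map_swap 0 1 x).symm

/-- The transposition of the two adjoined points `0` and `1`. -/
def transposePoints : iota ⋙ iota ⟶ iota ⋙ iota where
  app a := (Equiv.swap (0 : Fin (a.card + 2)) 1).toEmbedding
  naturality _ _ f := Function.Embedding.ext fun x => swap_extendEmb_extendEmb f x

lemma transposePoints_transposePoints (a : FI) :
    transposePoints.app a ≫ transposePoints.app a = 𝟙 _ :=
  Function.Embedding.ext fun x : Fin (a.card + 2) =>
    Equiv.swap_apply_self 0 1 x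

lemma swap_extendEmb_succEmb {a : ℕ} (x : Fin (a + 1)) :
    Equiv.swap (0 : Fin (a + 2)) 1 (extendEmb (Fin.succEmb a) x) = x.succ := by
  induction x using Fin.cases with
  | zero => exact Equiv.swap_apply_left _ _
  | succ x =>
    refine Equiv.swap_apply_of_ne_of_ne (Fin.succ_ne_zero _) fun h => ?_
    exact Fin.succ_ne_zero x (Fin.succ_injective _ (h.trans Fin.succ_zero_eq_one.symm))

lemma iota_map_addPoint_transposePoints (a : FI) :
    iota.map (addPoint.app a) ≫ transposePoints.app a = addPoint.app (iota.obj a) :=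
  Function.Embedding.ext fun x => swap_extendEmb_succEmb x

/-- The functor on one coordinate of `FI^m` that adjoins a point if `p` holds and does nothing
otherwise, so that `iotaAt i` is `iotaIf (j = i)` in the coordinate `j`. -/
abbrev iotaIf (p : Prop) [Decidable p] : FI ⥤ FI := if p then iota else 𝟭 FI

/-- The inclusion of a set into the set with a point adjoined if `p` holds. -/
def addPointIf (p : Prop) [inst : Decidable p] : 𝟭 FI ⟶ iotaIf p :=
  match inst with
  | isTrue _ => addPoint
  | isFalse _ => 𝟙 _

/-- The isomorphism that exchanges two points adjoined one after the other. -/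
def transposeIf (p q : Prop) [ip : Decidable p] [iq : Decidable q] :
    iotaIf p ⋙ iotaIf q ⟶ iotaIf q ⋙ iotaIf p :=
  match ip, iq with
  | isTrue _, isTrue _ => transposePoints
  | isTrue _, isFalse _ => 𝟙 iota
  | isFalse _, isTrue _ => 𝟙 iota
  | isFalse _, isFalse _ => 𝟙 (𝟭 FI)

lemma transposeIf_transposeIf (p q : Prop) [ip : Decidable p] [iq : Decidable q] (a : FI) :
    (transposeIf p q).app a ≫ (transposeIf q p).app a = 𝟙 _ := by
  rcases ip with hp | hp <;> rcases iq with hq | hq <;>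
    first | exact transposePoints_transposePoints a | rfl

lemma iotaIf_map_addPointIf_transposeIf (p q : Prop) [ip : Decidable p] [iq : Decidable q]
    (a : FI) :
    (iotaIf q).map ((addPointIf p).app a) ≫ (transposeIf p q).app a =
      (addPointIf p).app ((iotaIf q).obj a) := by
  rcases ip with hp | hp <;> rcases iq with hq | hq <;>
    first | exact iota_map_addPoint_transposePoints a | rfl | exact iota.map_id a

lemma addPoint_cancel {a b : FI} {f g : a ⟶ b}
    (h : f ≫ addPoint.app b = g ≫ addPoint.app b) : f = g :=
  Function.Embedding.ext fun x =>
    Fin.succ_injective _ (DFunLike.congr_fun (F := Fin a.card ↪ Fin (b.card + 1)) h x)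

lemma addPointIf_cancel (p : Prop) [ip : Decidable p] {a b : FI} {f g : a ⟶ b}
    (h : f ≫ (addPointIf p).app b = g ≫ (addPointIf p).app b) : f = g := by
  rcases ip with hp | hp
  · exact h
  · exact addPoint_cancel h

/-- An injection into a set with an adjoined point either misses this point, or is, up to a
bijection of its source, obtained by adjoining a point to another injection. -/
lemma addPoint_dichotomy {a b : FI} (f : a ⟶ iota.obj b) :
    (∃ g : a ⟶ b, g ≫ addPoint.app b = f) ∨
      ∃ (c : FI) (e : a ⟶ iota.obj c) (g : c ⟶ b), a = iota.obj c ∧ e ≫ iota.map g = f := by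
  obtain ⟨a⟩ := a
  let f' : Fin a ↪ Fin (b.card + 1) := f
  by_cases h : ∃ x, f' x = 0
  · right
    obtain ⟨x, hx⟩ := h
    obtain _ | a := a
    · exact x.elim0
    let e : Equiv.Perm (Fin (a + 1)) := Equiv.swap 0 x
    have hne : ∀ y : Fin a, f' (e y.succ) ≠ 0 := by
      intro y hy
      have := f'.injective (hy.trans hx.symm)
      rw [show x = e 0 from (Equiv.swap_apply_left 0 x).symm] at this
      exact Fin.succ_ne_zero y (e.injective this)
    let g : Fin a ↪ Fin b.card :=
      ⟨fun y => (f' (e y.succ)).pred (hne y), fun y z hyz =>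
        Fin.succ_injective _ (e.injective (f'.injective (Fin.pred_inj.1 hyz)))⟩
    refine ⟨⟨a⟩, e.toEmbedding, g, rfl, Function.Embedding.ext fun y => ?_⟩
    change extendEmb g (e y) = f' y
    obtain ⟨z, rfl⟩ := e.surjective y
    rw [show e (e z) = z from Equiv.swap_apply_self 0 x z]
    induction z using Fin.cases with
    | zero => exact (((congrArg f' (Equiv.swap_apply_left 0 x)).trans hx)).symm
    | succ z => exact Fin.succ_pred _ (hne z)
  · left
    refine ⟨⟨fun y => (f' y).pred fun hy => h ⟨y, hy⟩, fun y z hyz =>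
      f'.injective (Fin.pred_inj.1 hyz)⟩,
      Function.Embedding.ext fun y => Fin.succ_pred (f' y) fun hy => h ⟨y, hy⟩⟩

lemma addPointIf_dichotomy (p : Prop) [ip : Decidable p] {a b : FI} (f : a ⟶ (iotaIf p).obj b) :
    (∃ g : a ⟶ b, g ≫ (addPointIf p).app b = f) ∨
      ∃ (c : FI) (e : a ⟶ (iotaIf p).obj c) (g : c ⟶ b),
        a = (iotaIf p).obj c ∧ e ≫ (iotaIf p).map g = f := by
  rcases ip with hp | hp
  · exact Or.inl ⟨f, rfl⟩
  · exact addPoint_dichotomy f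

lemma exists_comp_addPointIf {p : Prop} [ip : Decidable p] (hp : ¬p) {a b : FI}
    (f : a ⟶ (iotaIf p).obj b) : ∃ g : a ⟶ b, g ≫ (addPointIf p).app b = f := by
  rcases ip with _ | h
  · exact ⟨f, rfl⟩
  · exact absurd h hp

lemma exists_comp_iotaIf_map {p : Prop} [ip : Decidable p] (hp : ¬p) {a b : FI}
    (f : a ⟶ (iotaIf p).obj b) :
    ∃ (c : FI) (e : a ⟶ (iotaIf p).obj c) (g : c ⟶ b),
      a = (iotaIf p).obj c ∧ e ≫ (iotaIf p).map g = f := by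
  rcases ip with _ | h
  · exact ⟨a, 𝟙 a, f, rfl, Category.id_comp _⟩
  · exact absurd h hp

/-- If an injection misses the adjoined point after composition with the extension of another
injection, then it misses the adjoined point already. -/
lemma addPoint_cartesian {a b c : FI} (f : a ⟶ iota.obj b) (g : b ⟶ c) (h : a ⟶ c)
    (w : h ≫ addPoint.app c = f ≫ iota.map g) : ∃ h' : a ⟶ b, h' ≫ addPoint.app b = f := by
  let f' : Fin a.card ↪ Fin (b.card + 1) := f
  have hne : ∀ x, f' x ≠ 0 := by
    intro x hx
    have h1 : Fin.succ ((show Fin a.card ↪ Fin c.card from h) x) = extendEmb g (f' x) :=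
      DFunLike.congr_fun (F := Fin a.card ↪ Fin (c.card + 1)) w x
    rw [hx] at h1
    exact Fin.succ_ne_zero _ h1
  exact ⟨⟨fun y => (f' y).pred (hne y), fun y z hyz => f'.injective (Fin.pred_inj.1 hyz)⟩,
    Function.Embedding.ext fun y => Fin.succ_pred (f' y) (hne y)⟩

lemma addPointIf_cartesian (p : Prop) [ip : Decidable p] {a b c : FI}
    (f : a ⟶ (iotaIf p).obj b) (g : b ⟶ c) (h : a ⟶ c)
    (w : h ≫ (addPointIf p).app c = f ≫ (iotaIf p).map g) :
    ∃ h' : a ⟶ b, h' ≫ (addPointIf p).app b = f := by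
  rcases ip with hp | hp
  · exact ⟨f, rfl⟩
  · exact addPoint_cartesian f g h w

lemma exists_eq_iotaIf_obj {p : Prop} [ip : Decidable p] {a : FI} (h : p → 0 < a.card) :
    ∃ b, a = (iotaIf p).obj b := by
  rcases ip with hp | hp
  · exact ⟨a, rfl⟩
  · exact ⟨⟨a.card - 1⟩, FI.ext (Nat.succ_pred_eq_of_pos (h hp)).symm⟩

variable {k : Type u} [CommRing k] {m : ℕ}

/-- The natural inclusion of `a` into `a + e_c`. -/
def incl (c : Fin m) (a : FIPow m) : a ⟶ (iotaAt c).obj a :=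
  fun j => (addPointIf (j = c)).app (a j)

lemma incl_naturality (c : Fin m) {a b : FIPow m} (f : a ⟶ b) :
    f ≫ incl c b = incl c a ≫ (iotaAt c).map f :=
  funext fun j => (addPointIf (j = c)).naturality (f j)

/-- The isomorphism `a + e_c + e_b ≅ a + e_b + e_c` that exchanges the two adjoined points. For
`b = c` it is not the identity. -/
def braid (c b : Fin m) (a : FIPow m) :
    (iotaAt b).obj ((iotaAt c).obj a) ⟶ (iotaAt c).obj ((iotaAt b).obj a) :=
  fun j => (transposeIf (j = c) (j = b)).app (a j)

lemma braid_naturality (c b : Fin m) {a a' : FIPow m} (f : a ⟶ a') :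
    (iotaAt b).map ((iotaAt c).map f) ≫ braid c b a' =
      braid c b a ≫ (iotaAt c).map ((iotaAt b).map f) :=
  funext fun j => (transposeIf (j = c) (j = b)).naturality (f j)

lemma braid_braid (c b : Fin m) (a : FIPow m) :
    braid c b a ≫ braid b c a = 𝟙 _ :=
  funext fun _ => transposeIf_transposeIf _ _ _

lemma iotaAt_map_incl_braid (c b : Fin m) (a : FIPow m) :
    (iotaAt b).map (incl c a) ≫ braid c b a = incl c ((iotaAt b).obj a) :=
  funext fun _ => iotaIf_map_addPointIf_transposeIf _ _ _

lemma incl_braid (c b : Fin m) (a : FIPow m) :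
    incl c ((iotaAt b).obj a) ≫ braid b c a = (iotaAt b).map (incl c a) := by
  rw [← iotaAt_map_incl_braid, Category.assoc, braid_braid,
    Category.comp_id]

lemma incl_cancel (c : Fin m) {a b : FIPow m} {f g : a ⟶ b}
    (h : f ≫ incl c b = g ≫ incl c b) : f = g :=
  funext fun j => addPointIf_cancel (j = c) (congrFun h j)

/-- The naturality squares of `incl c` are cartesian. -/
lemma incl_cartesian (c : Fin m) {a b d : FIPow m} (f : a ⟶ (iotaAt c).obj b) (g : b ⟶ d)
    (h : a ⟶ d) (w : h ≫ incl c d = f ≫ (iotaAt c).map g) :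
    ∃ h' : a ⟶ b, h' ≫ incl c b = f := by
  choose h' w' using fun j => addPointIf_cartesian (j = c) (f j) (g j) (h j) (congrFun w j)
  exact ⟨h', funext w'⟩

/-- A morphism to `b + e_c` either misses the adjoined point, or is obtained, up to an isomorphism
of its source, by adjoining a point to a morphism to `b`. -/
lemma incl_dichotomy (c : Fin m) {a b : FIPow m} (f : a ⟶ (iotaAt c).obj b) :
    (∃ g : a ⟶ b, g ≫ incl c b = f) ∨
      ∃ (d : FIPow m) (e : a ⟶ (iotaAt c).obj d) (g : d ⟶ b),
        a = (iotaAt c).obj d ∧ e ≫ (iotaAt c).map g = f := by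
  rcases addPointIf_dichotomy (c = c) (f c) with h | h
  · left
    have h' : ∀ j, ∃ g : a j ⟶ b j, g ≫ (addPointIf (j = c)).app (b j) = f j := by
      intro j
      by_cases hj : j = c
      · subst hj; exact h
      · exact exists_comp_addPointIf hj (f j)
    choose g w using h'
    exact ⟨g, funext w⟩
  · right
    have h' : ∀ j, ∃ (d : FI) (e : a j ⟶ (iotaIf (j = c)).obj d) (g : d ⟶ b j),
        a j = (iotaIf (j = c)).obj d ∧ e ≫ (iotaIf (j = c)).map g = f j := by
      intro j
      by_cases hj : j = c
      · subst hj; exact h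
      · exact exists_comp_iotaIf_map hj (f j)
    choose d e g h₁ h₂ using h'
    exact ⟨d, e, g, funext h₁, funext h₂⟩

lemma exists_eq_iotaAt_obj {c : Fin m} {a : FIPow m} (h : 0 < (a c).card) :
    ∃ b, a = (iotaAt c).obj b := by
  choose b hb using fun j => exists_eq_iotaIf_obj (p := j = c) (a := a j)
    (fun hj => by subst hj; exact h)
  exact ⟨b, funext hb⟩

lemma card_iotaAt_self (c : Fin m) (a : FIPow m) :
    ((iotaAt c).obj a c).card = (a c).card + 1 := by
  rw [iotaAt_obj_card, Pi.single_eq_same]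

lemma total_iotaAt (c : Fin m) (a : FIPow m) : total ((iotaAt c).obj a) = total a + 1 := by
  simp [total, iotaAt_obj_card, Finset.sum_add_distrib]

lemma ne_iotaAt_obj (c : Fin m) (a : FIPow m) : a ≠ (iotaAt c).obj a := fun h => by
  have := card_iotaAt_self c a
  rw [← h] at this
  omega

/-- Every object of `FI^m` is obtained from the zero object by adjoining points. -/
lemma FIPow.induction {motive : FIPow m → Prop} (zero : ∀ n, total n = 0 → motive n)
    (step : ∀ c n, motive n → motive ((iotaAt c).obj n)) (n : FIPow m) : motive n := by
  induction h : total n generalizing n with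
  | zero => exact zero n h
  | succ t ih =>
    obtain ⟨c, hc⟩ : ∃ c, 0 < (n c).card := by
      by_contra! hn
      have : total n = 0 := Finset.sum_eq_zero fun j _ => Nat.le_zero.1 (hn j)
      omega
    obtain ⟨n', rfl⟩ := exists_eq_iotaAt_obj hc
    rw [total_iotaAt] at h
    exact step c n' (ih n' (by omega))

lemma eq_of_hom_of_total_eq_zero {a n : FIPow m} (f : a ⟶ n) (h : total n = 0) : a = n := by
  funext j
  have h₀ : (n j).card = 0 := (Finset.sum_eq_zero_iff.1 h) j (Finset.mem_univ j)
  have h₁ : (a j).card ≤ (n j).card := by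
    simpa using Fintype.card_le_of_embedding (show Fin (a j).card ↪ Fin (n j).card from f j)
  exact FI.ext (by omega)

/-! ### Derivatives -/

lemma map_map (V : FIMod k m) {a b c : FIPow m} (f : a ⟶ b) (g : b ⟶ c) (x : V.obj a) :
    V.map g (V.map f x) = V.map (f ≫ g) x := by simp

lemma app_map {V W : FIMod k m} (α : V ⟶ W) {a b : FIPow m} (f : a ⟶ b) (x : V.obj a) :
    α.app b (V.map f x) = W.map f (α.app a x) := NatTrans.naturality_apply α f x

/-- The canonical map `V ⟶ Σ_c V`, natural in `V`. -/
def toShift (c : Fin m) (V : FIMod k m) : V ⟶ (shift k c).obj V where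
  app n := V.map (incl c n)
  naturality a b f := by
    change V.map f ≫ V.map _ = V.map _ ≫ V.map ((iotaAt c).map f)
    rw [← V.map_comp, ← V.map_comp]
    exact congrArg _ (incl_naturality c f)

lemma toShift_naturality (c : Fin m) {V W : FIMod k m} (α : V ⟶ W) :
    toShift c V ≫ (shift k c).map α = α ≫ toShift c W := by
  ext n : 2
  exact α.naturality _

/-- The image of `V_n` in `V_{n + e_c}`. -/
abbrev inclRange (c : Fin m) (V : FIMod k m) (n : FIPow m) :
    Submodule k (V.obj ((iotaAt c).obj n)) :=
  LinearMap.range (V.map (incl c n)).hom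

lemma inclRange_le_comap_map (c : Fin m) (V : FIMod k m) {n p : FIPow m} (g : n ⟶ p) :
    inclRange c V n ≤ (inclRange c V p).comap (V.map ((iotaAt c).map g)).hom := by
  rintro _ ⟨x, rfl⟩
  refine ⟨V.map g x, ?_⟩
  change V.map _ (V.map _ x) = V.map _ (V.map _ x)
  rw [map_map, map_map]
  exact congrArg (fun f => V.map f x) (incl_naturality c g)

lemma inclRange_le_comap_app (c : Fin m) {V W : FIMod k m} (α : V ⟶ W) (n : FIPow m) :
    inclRange c V n ≤ (inclRange c W n).comap (α.app ((iotaAt c).obj n)).hom := by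
  rintro _ ⟨x, rfl⟩
  exact ⟨α.app n x, (app_map α _ x).symm⟩

/-- The derivative `D_c V`, the cokernel of `V ⟶ Σ_c V`. -/
noncomputable def deriv (c : Fin m) : FIMod k m ⥤ FIMod k m where
  obj V :=
    { obj n := ModuleCat.of k (V.obj ((iotaAt c).obj n) ⧸ inclRange c V n)
      map g := ModuleCat.ofHom
        (Submodule.mapQ _ _ (V.map ((iotaAt c).map g)).hom (inclRange_le_comap_map c V g))
      map_id n := by
        ext : 1
        refine Submodule.linearMap_qext _ ?_
        ext x
        simp
      map_comp g h := by
        ext : 1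
        refine Submodule.linearMap_qext _ ?_
        ext x
        simp }
  map α :=
    { app n := ModuleCat.ofHom
        (Submodule.mapQ _ _ (α.app ((iotaAt c).obj n)).hom (inclRange_le_comap_app c α n))
      naturality n p g := by
        ext : 1
        refine Submodule.linearMap_qext _ ?_
        ext x
        simp [NatTrans.naturality_apply] }
  map_id V := by
    ext n : 3
    refine Submodule.linearMap_qext _ ?_
    ext x
    simp
  map_comp α β := by
    ext n : 3
    refine Submodule.linearMap_qext _ ?_
    ext x
    simp

/-- The projection `Σ_c V ⟶ D_c V`, on elements. -/
def toDeriv (c : Fin m) (V : FIMod k m) (n : FIPow m) :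
    V.obj ((iotaAt c).obj n) →ₗ[k] ((deriv c).obj V).obj n :=
  Submodule.mkQ (inclRange c V n)

section toDeriv

variable (c : Fin m) {V W : FIMod k m}

lemma toDeriv_surjective (V : FIMod k m) (n : FIPow m) : Function.Surjective (toDeriv c V n) :=
  Submodule.mkQ_surjective _

lemma toDeriv_eq_zero_iff {n : FIPow m} (x : V.obj ((iotaAt c).obj n)) :
    toDeriv c V n x = 0 ↔ ∃ y, V.map (incl c n) y = x :=
  Submodule.Quotient.mk_eq_zero _

lemma toDeriv_incl {n : FIPow m} (y : V.obj n) :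
    toDeriv c V n (V.map (incl c n) y) = 0 :=
  (toDeriv_eq_zero_iff c _).2 ⟨y, rfl⟩

lemma deriv_map_app (α : V ⟶ W) {n : FIPow m} (x : V.obj ((iotaAt c).obj n)) :
    ((deriv c).map α).app n (toDeriv c V n x) = toDeriv c W n (α.app _ x) := rfl

lemma deriv_obj_map (V : FIMod k m) {n p : FIPow m} (g : n ⟶ p)
    (x : V.obj ((iotaAt c).obj n)) :
    ((deriv c).obj V).map g (toDeriv c V n x) = toDeriv c V p (V.map ((iotaAt c).map g) x) := rfl

end toDeriv

/-! ### Short exact sequences, elementwise -/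

/-- A sequence `A ⟶ B ⟶ C ⟶ 0` that is exact at every object of `FI^m`. -/
structure RightExact {A B C : FIMod k m} (f : A ⟶ B) (g : B ⟶ C) : Prop where
  surj : ∀ n, Function.Surjective (g.app n)
  comp_eq_zero : ∀ n x, g.app n (f.app n x) = 0
  exact : ∀ n y, g.app n y = 0 → ∃ x, f.app n x = y

/-- A sequence `0 ⟶ A ⟶ B ⟶ C ⟶ 0` that is exact at every object of `FI^m`. -/
structure SES {A B C : FIMod k m} (f : A ⟶ B) (g : B ⟶ C) : Prop extends RightExact f g where
  inj : ∀ n, Function.Injective (f.app n)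

/-- `V ⟶ Σ_c V` is injective. -/
def TorsionFree (c : Fin m) (V : FIMod k m) : Prop :=
  ∀ n, Function.Injective (V.map (incl c n))

/-- All values of `V` are zero. -/
def Null (V : FIMod k m) : Prop := ∀ n (x : V.obj n), x = 0

lemma injective_app {V W : FIMod k m} {f : V ⟶ W} {n : FIPow m}
    (h : ∀ x, f.app n x = 0 → x = 0) : Function.Injective (f.app n) :=
  (injective_iff_map_eq_zero (f.app n).hom).2 h

lemma injective_map {V : FIMod k m} {n p : FIPow m} {g : n ⟶ p}
    (h : ∀ x, V.map g x = 0 → x = 0) : Function.Injective (V.map g) :=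
  (injective_iff_map_eq_zero (V.map g).hom).2 h

section sequences

variable {A B C : FIMod k m} {f : A ⟶ B} {g : B ⟶ C} (c : Fin m)

lemma deriv_map_surjective (hg : ∀ n, Function.Surjective (g.app n)) (n : FIPow m) :
    Function.Surjective (((deriv c).map g).app n) := by
  intro y
  obtain ⟨y, rfl⟩ := toDeriv_surjective c C n y
  obtain ⟨x, rfl⟩ := hg _ y
  exact ⟨toDeriv c B n x, rfl⟩

lemma RightExact.deriv (h : RightExact f g) :
    RightExact ((deriv c).map f) ((deriv c).map g) where
  surj := deriv_map_surjective c h.surj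
  comp_eq_zero n x := by
    obtain ⟨x, rfl⟩ := toDeriv_surjective c A n x
    rw [deriv_map_app, deriv_map_app, h.comp_eq_zero, map_zero]
  exact n y hy := by
    obtain ⟨y, rfl⟩ := toDeriv_surjective c B n y
    rw [deriv_map_app, toDeriv_eq_zero_iff] at hy
    obtain ⟨z, hz⟩ := hy
    obtain ⟨z, rfl⟩ := h.surj _ z
    obtain ⟨x, hx⟩ := h.exact _ (y - B.map (incl c n) z) (by
      rw [map_sub, app_map, hz, sub_self])
    refine ⟨toDeriv c A n x, ?_⟩
    rw [deriv_map_app, hx, map_sub, toDeriv_incl, sub_zero]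

/-- The snake lemma for the natural map to the shift, where the torsion of `C` vanishes. -/
lemma SES.deriv (h : SES f g) (hC : TorsionFree c C) :
    SES ((deriv c).map f) ((deriv c).map g) where
  toRightExact := h.toRightExact.deriv c
  inj n := by
    refine injective_app fun x hx => ?_
    obtain ⟨x, rfl⟩ := toDeriv_surjective c A n x
    rw [deriv_map_app, toDeriv_eq_zero_iff] at hx
    obtain ⟨y, hy⟩ := hx
    have hgy : g.app n y = 0 := by
      apply hC n
      rw [← app_map, hy, h.comp_eq_zero, map_zero]
    obtain ⟨z, rfl⟩ := h.exact n y hgy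
    rw [← app_map] at hy
    rw [← h.inj _ hy, toDeriv_incl]

lemma TorsionFree.of_injective {c : Fin m} (hB : TorsionFree c B)
    (hf : ∀ n, Function.Injective (f.app n)) : TorsionFree c A := fun n x y hxy => by
  apply hf n
  apply hB n
  rw [← app_map, ← app_map, hxy]

lemma Null.of_injective (hB : Null B) (hf : ∀ n, Function.Injective (f.app n)) : Null A :=
  fun n x => hf n (by rw [hB n (f.app n x), map_zero])

lemma Null.of_surjective (hB : Null B) (hg : ∀ n, Function.Surjective (g.app n)) : Null C :=
  fun n x => by
    obtain ⟨y, rfl⟩ := hg n x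
    rw [hB n y, map_zero]

lemma RightExact.null (h : RightExact f g) (hA : Null A) (hC : Null C) : Null B := fun n y => by
  obtain ⟨x, rfl⟩ := h.exact n y (hC n _)
  rw [hA n x, map_zero]

/-- The kernel of a homomorphism, computed at each object. -/
noncomputable def ker (g : B ⟶ C) : FIMod k m where
  obj n := ModuleCat.of k (LinearMap.ker (g.app n).hom)
  map φ := ModuleCat.ofHom (LinearMap.restrict (B.map φ).hom fun x hx => by
    change g.app _ (B.map φ x) = 0
    rw [app_map, show g.app _ x = 0 from hx, map_zero])
  map_id n := by
    ext x : 3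
    exact congrArg (fun f => f x.1) (congrArg ModuleCat.Hom.hom (B.map_id n))
  map_comp φ ψ := by
    ext x : 3
    exact congrArg (fun f => f x.1) (congrArg ModuleCat.Hom.hom (B.map_comp φ ψ))

/-- The inclusion of the kernel. -/
noncomputable def ker.ι (g : B ⟶ C) : ker g ⟶ B where
  app n := ModuleCat.ofHom (LinearMap.ker (g.app n).hom).subtype

/-- A homomorphism that `g` annihilates factors through the kernel of `g`. -/
noncomputable def ker.lift (g : B ⟶ C) (f : A ⟶ B) (h : ∀ n x, g.app n (f.app n x) = 0) :
    A ⟶ ker g where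
  app n := ModuleCat.ofHom ((f.app n).hom.codRestrict _ (h n))
  naturality a b φ := by
    ext x
    exact Subtype.ext (app_map f φ x)

lemma ker.ι_injective (g : B ⟶ C) (n : FIPow m) : Function.Injective ((ker.ι g).app n) :=
  Subtype.val_injective

lemma ker.ses (g : B ⟶ C) (hg : ∀ n, Function.Surjective (g.app n)) : SES (ker.ι g) g where
  surj := hg
  comp_eq_zero _ x := x.2
  exact _ y hy := ⟨⟨y, hy⟩, rfl⟩
  inj := ker.ι_injective g

lemma ker.lift_surjective (h : RightExact f g) (n : FIPow m) :
    Function.Surjective ((ker.lift g f h.comp_eq_zero).app n) := by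
  rintro ⟨y, hy⟩
  obtain ⟨x, hx⟩ := h.exact n y hy
  exact ⟨x, Subtype.ext hx⟩

end sequences

/-- The iterated derivative `D_w V` along a list `w` of directions, the head of which is applied
first. -/
noncomputable def derivList : List (Fin m) → FIMod k m → FIMod k m
  | [], V => V
  | c :: w, V => derivList w ((deriv c).obj V)

/-- The effect of the iterated derivative on homomorphisms. -/
noncomputable def derivListMap : ∀ (w : List (Fin m)) {V W : FIMod k m}, (V ⟶ W) →
    (derivList w V ⟶ derivList w W)
  | [], _, _, α => α
  | c :: w, _, _, α => derivListMap w ((deriv c).map α)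

/-- The iterated derivative `D_c^g V` in one direction. -/
noncomputable abbrev derivIter (c : Fin m) (g : ℕ) (V : FIMod k m) : FIMod k m :=
  derivList (List.replicate g c) V

lemma RightExact.derivList (w : List (Fin m)) {A B C : FIMod k m} {α : A ⟶ B} {β : B ⟶ C}
    (h : RightExact α β) : RightExact (derivListMap w α) (derivListMap w β) := by
  induction w generalizing A B C with
  | nil => exact h
  | cons c w ih => exact ih (h.deriv c)

lemma derivListMap_surjective (w : List (Fin m)) {B C : FIMod k m} {β : B ⟶ C}
    (h : ∀ n, Function.Surjective (β.app n)) (n : FIPow m) :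
    Function.Surjective ((derivListMap w β).app n) := by
  induction w generalizing B C with
  | nil => exact h n
  | cons c w ih => exact ih (deriv_map_surjective c h)

lemma Null.deriv (c : Fin m) {V : FIMod k m} (hV : Null V) : Null ((deriv c).obj V) :=
  fun n x => by
    obtain ⟨x, rfl⟩ := toDeriv_surjective c V n x
    rw [hV _ x, map_zero]

lemma Null.derivIter_of_le (c : Fin m) {g g' : ℕ} (h : g ≤ g') {V : FIMod k m}
    (hV : Null (derivIter c g V)) : Null (derivIter c g' V) := by
  induction g' generalizing g V with
  | zero => rwa [Nat.le_zero.1 h] at hV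
  | succ g' ih =>
    cases g with
    | zero => exact ih (Nat.zero_le _) (Null.deriv c (V := V) hV)
    | succ g => exact ih (Nat.le_of_succ_le_succ h) hV

/-- All iterated derivatives of `V` are torsion free in all directions. -/
def DerivTorsionFree (V : FIMod k m) : Prop := ∀ w c, TorsionFree c (derivList w V)

lemma DerivTorsionFree.deriv (c : Fin m) {V : FIMod k m} (hV : DerivTorsionFree V) :
    DerivTorsionFree ((deriv c).obj V) := fun w => hV (c :: w)

lemma SES.derivList (w : List (Fin m)) {A B C : FIMod k m} {α : A ⟶ B} {β : B ⟶ C}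
    (h : SES α β) (hC : DerivTorsionFree C) : SES (derivListMap w α) (derivListMap w β) := by
  induction w generalizing A B C with
  | nil => exact h
  | cons c w ih => exact ih (h.deriv c (hC [] c)) (hC.deriv c)

lemma SES.derivTorsionFree {A B C : FIMod k m} {α : A ⟶ B} {β : B ⟶ C}
    (h : SES α β) (hB : DerivTorsionFree B) (hC : DerivTorsionFree C) : DerivTorsionFree A :=
  fun w c => (hB w c).of_injective (h.derivList w hC).inj

/-! ### Torsion in one direction -/

/-- The homomorphisms that adjoin a point in the direction `c` act by zero on `Y`. -/
def TrivialAction (c : Fin m) (Y : FIMod k m) : Prop :=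
  ∀ n (y : Y.obj n), Y.map (incl c n) y = 0

/-- `Y_n = 0` whenever `n_c ≥ g`. -/
def VanishesFrom (c : Fin m) (g : ℕ) (Y : FIMod k m) : Prop :=
  ∀ n, g ≤ (n c).card → ∀ y : Y.obj n, y = 0

section direction

variable {c : Fin m}

lemma VanishesFrom.null_derivIter {g : ℕ} {Y : FIMod k m} (h : VanishesFrom c g Y) :
    Null (derivIter c g Y) := by
  induction g generalizing Y with
  | zero => exact fun n => h n (Nat.zero_le _)
  | succ g ih =>
    refine ih (Y := (deriv c).obj Y) fun n hn x => ?_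
    obtain ⟨x, rfl⟩ := toDeriv_surjective c Y n x
    rw [h _ (by rw [card_iotaAt_self]; omega) x, map_zero]

lemma TrivialAction.deriv {Y : FIMod k m} (h : TrivialAction c Y) :
    TrivialAction c ((deriv c).obj Y) := fun n x => by
  obtain ⟨x, rfl⟩ := toDeriv_surjective c Y n x
  rw [deriv_obj_map, ← incl_braid, ← map_map, h, map_zero, map_zero]

/-- If points in the direction `c` act by zero on `Y`, then `D_c Y` is `Σ_c Y`. -/
lemma TrivialAction.vanishesFrom {g : ℕ} {Y : FIMod k m} (h : TrivialAction c Y)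
    (hY : Null (derivIter c g Y)) : VanishesFrom c g Y := by
  induction g generalizing Y with
  | zero => exact fun n _ => hY n
  | succ g ih =>
    intro n hn x
    obtain ⟨n, rfl⟩ := exists_eq_iotaAt_obj (c := c) (a := n) (by omega)
    rw [card_iotaAt_self] at hn
    obtain ⟨y, rfl⟩ := (toDeriv_eq_zero_iff c x).1 (ih h.deriv hY n (by omega) _)
    exact h n y

/-- For `g' ≥ g`, the kernel of any surjection `B ⟶ C` with `D_c^{g' + 1} B = 0` is annihilated by
`D_c^{g' + 1}` as well. As `D_c^{p} V = 0` says that `V` is generated in degrees `< p` in the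
direction `c`, this is an upper bound for the degrees of the relations of `C`. -/
def RelationBound (c : Fin m) (g : ℕ) (C : FIMod k m) : Prop :=
  ∀ g', g ≤ g' → ∀ (A B : FIMod k m) (f : A ⟶ B) (h : B ⟶ C), SES f h →
    Null (derivIter c (g' + 1) B) → Null (derivIter c (g' + 1) A)

lemma RelationBound.mono {g g' : ℕ} {C : FIMod k m} (h : RelationBound c g C) (hg : g ≤ g') :
    RelationBound c g' C := fun i hi => h i (hg.trans hi)

lemma Null.relationBound {C : FIMod k m} (hC : Null C) (g : ℕ) : RelationBound c g C := by
  intro g' _ A B f h hs hB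
  have : IsIso f := by
    rw [NatTrans.isIso_iff_isIso_app]
    intro n
    rw [ConcreteCategory.isIso_iff_bijective]
    exact ⟨hs.inj n, fun y => hs.exact n y (hC n _)⟩
  refine hB.of_surjective (g := derivListMap _ (inv f)) (derivListMap_surjective _ fun n x => ?_)
  refine ⟨f.app n x, ?_⟩
  rw [← ModuleCat.comp_apply, ← NatTrans.comp_app, IsIso.hom_inv_id]
  rfl

/-- Relation bounds pass to extensions. -/
lemma RelationBound.of_ker {g : ℕ} {C C' : FIMod k m} {q : C ⟶ C'}
    (hq : ∀ n, Function.Surjective (q.app n)) (h : RelationBound c g (ker q))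
    (h' : RelationBound c g C') : RelationBound c g C := by
  intro g' hg A B f p hs hB
  have hpq : SES (ker.ι (p ≫ q)) (p ≫ q) :=
    ker.ses _ fun n => (hq n).comp (hs.surj n)
  refine h g' hg A (ker (p ≫ q))
    (ker.lift _ f fun n x => (congrArg (q.app n) (hs.comp_eq_zero n x)).trans (map_zero _))
    (ker.lift q (ker.ι (p ≫ q) ≫ p) fun n x => x.2) ?_ (h' g' hg _ _ _ _ hpq hB)
  refine ⟨⟨?_, ?_, ?_⟩, ?_⟩
  · rintro n ⟨y, hy⟩
    obtain ⟨x, rfl⟩ := hs.surj n y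
    exact ⟨⟨x, hy⟩, rfl⟩
  · exact fun n x => Subtype.ext (hs.comp_eq_zero n x)
  · rintro n ⟨y, hy⟩ h0
    obtain ⟨x, rfl⟩ := hs.exact n y (congrArg Subtype.val h0)
    exact ⟨x, rfl⟩
  · exact fun n x y hxy => hs.inj n (congrArg Subtype.val hxy)

lemma RelationBound.of_deriv {g : ℕ} {C : FIMod k m} (hC : TorsionFree c C)
    (h : RelationBound c g ((FIModule.deriv c).obj C)) : RelationBound c (g + 1) C := by
  intro g' hg A B f p hs hB
  obtain ⟨g', rfl⟩ := Nat.exists_eq_add_of_le' hg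
  exact h (g' + g) (by omega) _ _ _ _ (hs.deriv c hC) hB

lemma TrivialAction.relationBound {g : ℕ} {Y : FIMod k m} (hY : TrivialAction c Y)
    (hg : VanishesFrom c g Y) : RelationBound c g Y := by
  induction g generalizing Y with
  | zero => exact Null.relationBound (fun n => hg n (Nat.zero_le _)) 0
  | succ g ih =>
    intro g' hgg A B f p hs hB
    obtain ⟨g', rfl⟩ : ∃ i, g' = i + 1 := ⟨g' - 1, by omega⟩
    have hex := hs.toRightExact.deriv c
    -- `D_c A` is an extension of the image of `D_c A ⟶ D_c B` by the kernel of this map.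
    let ℓ := ker.lift _ _ hex.comp_eq_zero
    have hℓ : ∀ n, Function.Surjective (ℓ.app n) := ker.lift_surjective hex
    have hDY : VanishesFrom c g ((FIModule.deriv c).obj Y) := fun n hn x => by
      obtain ⟨x, rfl⟩ := toDeriv_surjective c Y n x
      rw [hg _ (by rw [card_iotaAt_self]; omega) x, map_zero]
    have himage : Null (derivIter c (g' + 1) (ker ((FIModule.deriv c).map p))) :=
      ih hY.deriv hDY g' (by omega) _ _ _ _ (ker.ses _ hex.surj) hB
    have hker : VanishesFrom c (g + 1) (ker ℓ) := by
      rintro n hn ⟨x, hx⟩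
      refine Subtype.ext ?_
      change x = 0
      obtain ⟨a, rfl⟩ := toDeriv_surjective c A n x
      have hx' : toDeriv c B n (f.app _ a) = 0 := congrArg Subtype.val hx
      obtain ⟨b, hb⟩ := (toDeriv_eq_zero_iff c _).1 hx'
      obtain ⟨a', rfl⟩ := hs.exact n b (hg n hn _)
      rw [← app_map] at hb
      rw [← hs.inj _ hb, toDeriv_incl]
    exact ((ker.ses ℓ hℓ).toRightExact.derivList _).null
      (hker.null_derivIter.derivIter_of_le c hgg) himage

/-- In a presentation `0 ⟶ U ⟶ P ⟶ V ⟶ 0`, the kernel of `D_c U ⟶ D_c P` measures the torsion of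
`V` in the direction `c`. -/
lemma SES.trivialAction_ker {U P V : FIMod k m} {f : U ⟶ P} {h : P ⟶ V} (hs : SES f h) :
    TrivialAction c (ker (ker.lift _ _ (hs.toRightExact.deriv c).comp_eq_zero)) := by
  rintro n ⟨y, hy⟩
  refine Subtype.ext ?_
  obtain ⟨u, rfl⟩ := toDeriv_surjective c U n y
  have hu : toDeriv c P n (f.app _ u) = 0 := congrArg Subtype.val hy
  obtain ⟨x, hx⟩ := (toDeriv_eq_zero_iff c _).1 hu
  change toDeriv c U _ (U.map ((iotaAt c).map (incl c n)) u) = 0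
  have key : U.map (incl c _) u = U.map ((iotaAt c).map (incl c n)) u := by
    apply hs.inj
    rw [app_map, app_map, ← hx, map_map, map_map, incl_naturality]
  rw [← key, toDeriv_incl]

/-- Let `0 ⟶ U ⟶ P ⟶ V ⟶ 0` be a presentation where the generators of `P` and `U` have degrees `< p`
and `< q` in the direction `c`, and where `P` has no torsion. The torsion of `V` in the direction
`c` is then bounded, and so are the relations of `U`. -/
theorem torsion_bound (p : ℕ) : ∀ (q : ℕ) {U P V : FIMod k m} {f : U ⟶ P} {h : P ⟶ V}
    (_ : SES f h) (_ : ∀ j, TorsionFree c (derivIter c j P)) (_ : Null (derivIter c p P))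
    (_ : Null (derivIter c q U)),
    (∀ g, p + q ≤ g + 1 → RelationBound c g U) ∧
      ∀ g, p + q ≤ g + 2 → ∀ n, g ≤ (n c).card → Function.Injective (V.map (incl c n)) := by
  have of_null : ∀ {U P V : FIMod k m} {f : U ⟶ P} {h : P ⟶ V} (_ : SES f h)
      (_ : TorsionFree c P) (_ : Null U), (∀ g, RelationBound c g U) ∧
        ∀ n, Function.Injective (V.map (incl c n)) := by
    intro U P V f h hs hP hU
    refine ⟨fun g => hU.relationBound g, fun n => injective_map fun v hv => ?_⟩
    obtain ⟨x, rfl⟩ := hs.surj n v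
    rw [← app_map] at hv
    obtain ⟨u, hu⟩ := hs.exact _ _ hv
    rw [hU _ u, map_zero] at hu
    rw [hP n (hu.symm.trans (map_zero _).symm), map_zero]
  induction p with
  | zero =>
    intro q U P V f h hs hPt hP hU
    have := of_null hs (hPt 0) (Null.of_injective (B := P) hP hs.inj)
    exact ⟨fun g _ => this.1 g, fun g _ n _ => this.2 n⟩
  | succ p ih =>
    intro q U P V f h hs hPt hP hU
    obtain _ | q := q
    · have := of_null hs (hPt 0) hU
      exact ⟨fun g _ => this.1 g, fun g _ n _ => this.2 n⟩
    have hex := hs.toRightExact.deriv c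
    -- The image `I` of `D_c U ⟶ D_c P` is the relation module of `D_c V`. The kernel `Y` of
    -- `D_c U ⟶ I` consists of the torsion of `V`.
    let ℓ := ker.lift _ _ hex.comp_eq_zero
    have hℓ : ∀ n, Function.Surjective (ℓ.app n) := ker.lift_surjective hex
    have hI := ih q (ker.ses _ hex.surj) (fun j => hPt (j + 1)) hP
      (Null.of_surjective (B := derivIter c q ((FIModule.deriv c).obj U)) hU
        (derivListMap_surjective _ hℓ))
    have hYtriv : TrivialAction c (ker ℓ) := hs.trivialAction_ker
    have hYnull : Null (derivIter c (p + q) (ker ℓ)) := by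
      have hDU : Null (derivIter c (p + q) ((FIModule.deriv c).obj U)) :=
        Null.derivIter_of_le c (by omega) (g := q) hU
      obtain h0 | ⟨g, hg⟩ : p + q = 0 ∨ ∃ g, p + q = g + 1 := by
        rcases p + q with _ | g
        exacts [Or.inl rfl, Or.inr ⟨g, rfl⟩]
      · rw [h0] at hDU ⊢
        exact Null.of_injective (B := (FIModule.deriv c).obj U) hDU (ker.ι_injective ℓ)
      · rw [hg] at hDU ⊢
        exact hI.1 g hg.le g le_rfl _ _ _ _ (ker.ses ℓ hℓ) hDU
    have hY : VanishesFrom c (p + q) (ker ℓ) := hYtriv.vanishesFrom hYnull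
    constructor
    · intro g hg
      obtain ⟨g, rfl⟩ : ∃ i, g = i + 1 := ⟨g - 1, by omega⟩
      have hU' : TorsionFree c U := (hPt 0).of_injective hs.inj
      exact RelationBound.of_deriv hU' (RelationBound.of_ker hℓ
        ((hYtriv.relationBound hY).mono (by omega)) (hI.1 g (by omega)))
    · intro g hg n hn
      refine injective_map fun v hv => ?_
      obtain ⟨x, rfl⟩ := hs.surj n v
      rw [← app_map] at hv
      obtain ⟨u, hu⟩ := hs.exact _ _ hv
      have hu0 : ℓ.app n (toDeriv c U n u) = 0 := by
        refine Subtype.ext ?_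
        change toDeriv c P n (f.app _ u) = 0
        rw [hu, toDeriv_incl]
      have := congrArg Subtype.val (hY n (by omega) ⟨toDeriv c U n u, hu0⟩)
      obtain ⟨u', rfl⟩ := (toDeriv_eq_zero_iff c u).1 this
      rw [app_map] at hu
      rw [← hPt 0 n hu, hs.comp_eq_zero]

end direction

/-! ### Derivatives and decomposable elements -/

/-- `H_0(V)` at `n + e_c` is `H_0(D_c V)` at `n`. -/
lemma toDeriv_mem_decomposable_iff (c : Fin m) {V : FIMod k m} {n : FIPow m}
    (x : V.obj ((iotaAt c).obj n)) :
    toDeriv c V n x ∈ decomposable ((deriv c).obj V) n ↔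
      x ∈ decomposable V ((iotaAt c).obj n) := by
  constructor
  · have hle : decomposable ((deriv c).obj V) n ≤
        (decomposable V ((iotaAt c).obj n)).map (toDeriv c V n) := by
      refine Submodule.span_le.2 ?_
      rintro _ ⟨a, ha, f, v, rfl⟩
      obtain ⟨v, rfl⟩ := toDeriv_surjective c V a v
      refine ⟨V.map ((iotaAt c).map f) v, Submodule.subset_span ⟨_, fun h => ha ?_, _, _, rfl⟩,
        rfl⟩
      funext j
      have := congrArg (fun b : FIPow m => (b j).card) h
      simp only [iotaAt_obj_card] at this
      exact FI.ext (by omega)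
    intro hx
    obtain ⟨y, hy, hyx⟩ := hle hx
    obtain ⟨z, hz⟩ := (toDeriv_eq_zero_iff c (x - y)).1 (by rw [map_sub, hyx, sub_self])
    rw [← sub_add_cancel x y]
    exact add_mem (Submodule.subset_span ⟨n, ne_iotaAt_obj c n, _, z, hz⟩) hy
  · suffices decomposable V ((iotaAt c).obj n) ≤
        (decomposable ((deriv c).obj V) n).comap (toDeriv c V n) from fun hx => this hx
    refine Submodule.span_le.2 ?_
    rintro _ ⟨a, ha, f, v, rfl⟩
    change toDeriv c V n (V.map f v) ∈ decomposable ((FIModule.deriv c).obj V) n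
    obtain ⟨g, rfl⟩ | ⟨d, e, g, hd, rfl⟩ := incl_dichotomy c f
    · rw [← map_map, toDeriv_incl]
      exact zero_mem _
    · rw [← map_map, ← deriv_obj_map]
      refine Submodule.subset_span ⟨d, ?_, g, _, rfl⟩
      rintro rfl
      exact ha hd

/-- `V` is generated by elements of degree `< p`, where `|n|` is the degree of an element of
`V_n`. -/
def GeneratedBelow (p : ℕ) (V : FIMod k m) : Prop :=
  ∀ n, p ≤ total n → decomposable V n = ⊤

lemma GeneratedBelow.deriv_succ {p : ℕ} {V : FIMod k m} (h : GeneratedBelow (p + 1) V)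
    (c : Fin m) : GeneratedBelow p ((deriv c).obj V) := fun n hn => by
  refine eq_top_iff.2 fun x _ => ?_
  obtain ⟨x, rfl⟩ := toDeriv_surjective c V n x
  rw [toDeriv_mem_decomposable_iff, h _ (by rw [total_iotaAt]; omega)]
  trivial

lemma GeneratedBelow.mono {p p' : ℕ} {V : FIMod k m} (h : GeneratedBelow p V) (hp : p ≤ p') :
    GeneratedBelow p' V := fun n hn => h n (hp.trans hn)

lemma GeneratedBelow.deriv {p : ℕ} {V : FIMod k m} (h : GeneratedBelow p V)
    (c : Fin m) : GeneratedBelow p ((FIModule.deriv c).obj V) :=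
  (h.mono p.le_succ).deriv_succ c

lemma GeneratedBelow.of_surjective {p : ℕ} {V W : FIMod k m} (h : GeneratedBelow p V)
    {α : V ⟶ W} (hα : ∀ n, Function.Surjective (α.app n)) : GeneratedBelow p W := fun n hn => by
  refine eq_top_iff.2 fun x _ => ?_
  obtain ⟨x, rfl⟩ := hα n x
  exact decomposable_le_comap_app α n ((h n hn).symm ▸ Submodule.mem_top)

lemma decomposable_eq_bot (V : FIMod k m) {n : FIPow m} (hn : total n = 0) :
    decomposable V n = ⊥ := by
  refine eq_bot_iff.2 (Submodule.span_le.2 ?_)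
  rintro _ ⟨a, ha, f, v, rfl⟩
  exact absurd (eq_of_hom_of_total_eq_zero f hn) ha

lemma GeneratedBelow.null {V : FIMod k m} (h : GeneratedBelow 0 V) : Null V := by
  intro n
  induction n using FIPow.induction generalizing V with
  | zero n hn =>
    intro x
    have hx : x ∈ decomposable V n := by rw [h n (Nat.zero_le _)]; trivial
    rwa [decomposable_eq_bot V hn, Submodule.mem_bot] at hx
  | step c n ih =>
    intro x
    obtain ⟨y, rfl⟩ := (toDeriv_eq_zero_iff c x).1 (ih (h.deriv c) _)
    rw [ih h y, map_zero]

lemma GeneratedBelow.null_derivIter {p : ℕ} {V : FIMod k m} (h : GeneratedBelow p V)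
    (c : Fin m) : Null (derivIter c p V) := by
  induction p generalizing V with
  | zero => exact h.null
  | succ p ih => exact ih (h.deriv_succ c)

/-- The derivatives control decomposability because `H_0(V)_n` is the value at `0` of the iterated derivative
of `V` with `n_j` derivatives in the direction `j`. -/
lemma mem_decomposable_of_injective {V W : FIMod k m} (α : V ⟶ W)
    (h : ∀ w n, Function.Injective ((derivListMap w α).app n)) (n : FIPow m) (x : V.obj n)
    (hx : α.app n x ∈ decomposable W n) : x ∈ decomposable V n := by
  induction n using FIPow.induction generalizing V W with
  | zero n hn =>
    rw [decomposable_eq_bot W hn, Submodule.mem_bot] at hx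
    rw [h [] n (hx.trans (map_zero _).symm)]
    exact zero_mem _
  | step c n ih =>
    rw [← toDeriv_mem_decomposable_iff] at hx ⊢
    exact ih ((deriv c).map α) (fun w => h (c :: w)) _ hx

/-! ### Derivatives of shifts -/

/-- The canonical map `D_c Σ_b V ⟶ Σ_b D_c V`, given by exchanging the two adjoined points. -/
noncomputable def derivShift (c b : Fin m) (V : FIMod k m) :
    (deriv c).obj ((shift k b).obj V) ⟶ (shift k b).obj ((deriv c).obj V) where
  app n := ModuleCat.ofHom (Submodule.mapQ (inclRange c ((shift k b).obj V) n)
    (inclRange c V ((iotaAt b).obj n)) (V.map (braid c b n)).hom (by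
      rintro _ ⟨(x : V.obj ((iotaAt b).obj n)), rfl⟩
      refine ⟨x, ?_⟩
      change V.map _ x = V.map _ (V.map ((iotaAt b).map (incl c n)) x)
      rw [map_map, iotaAt_map_incl_braid]))
  naturality n p g := by
    ext : 1
    refine Submodule.linearMap_qext _ 
      (LinearMap.ext fun (x : V.obj ((iotaAt b).obj ((iotaAt c).obj n))) => ?_)
    change toDeriv c V _ (V.map (braid c b p) (V.map ((iotaAt b).map ((iotaAt c).map g)) x)) =
      toDeriv c V _ (V.map ((iotaAt c).map ((iotaAt b).map g)) (V.map (braid c b n) x))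
    rw [map_map, map_map, braid_naturality]

lemma derivShift_app (c b : Fin m) (V : FIMod k m) {n : FIPow m}
    (x : V.obj ((iotaAt b).obj ((iotaAt c).obj n))) :
    (derivShift c b V).app n (toDeriv c ((shift k b).obj V) n x) =
      toDeriv c V ((iotaAt b).obj n) (V.map (braid c b n) x) := rfl

lemma map_braid_braid (V : FIMod k m) (c b : Fin m) (n : FIPow m)
    (x : V.obj ((iotaAt b).obj ((iotaAt c).obj n))) :
    V.map (braid b c n) (V.map (braid c b n) x) = x := by
  rw [map_map, braid_braid, V.map_id]
  rfl

lemma map_braid_injective (V : FIMod k m) (c b : Fin m) (n : FIPow m) :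
    Function.Injective (V.map (braid c b n)) :=
  Function.LeftInverse.injective (map_braid_braid V c b n)

instance (c b : Fin m) (V : FIMod k m) : IsIso (derivShift c b V) := by
  rw [NatTrans.isIso_iff_isIso_app]
  intro n
  rw [ConcreteCategory.isIso_iff_bijective]
  constructor
  · refine injective_app fun x hx => ?_
    obtain ⟨(x : V.obj ((iotaAt b).obj ((iotaAt c).obj n))), rfl⟩ :=
      toDeriv_surjective c ((shift k b).obj V) n x
    obtain ⟨y, hy⟩ := (toDeriv_eq_zero_iff c _).1 ((derivShift_app c b V x).symm.trans hx)
    refine (toDeriv_eq_zero_iff c _).2 ⟨y, ?_⟩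
    change V.map ((iotaAt b).map (incl c n)) y = x
    rw [← map_braid_braid V c b n x, ← hy, map_map, incl_braid]
  · intro x
    obtain ⟨x, rfl⟩ := toDeriv_surjective c V _ x
    refine ⟨toDeriv c ((shift k b).obj V) n (V.map (braid b c n) x), ?_⟩
    rw [derivShift_app, map_braid_braid]

lemma deriv_map_toShift (c b : Fin m) (V : FIMod k m) :
    (deriv c).map (toShift b V) ≫ derivShift c b V = toShift b ((deriv c).obj V) := by
  ext n x
  obtain ⟨x, rfl⟩ := toDeriv_surjective c V n x
  change toDeriv c V _ (V.map (braid c b n) (V.map (incl b _) x)) =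
    toDeriv c V _ (V.map ((iotaAt c).map (incl b n)) x)
  rw [map_map, incl_braid]

/-! ### Modules that are direct summands of their shifts -/

/-- All canonical maps `V ⟶ Σ_c V` are split. -/
def ShiftSplit (V : FIMod k m) : Prop := ∀ c, IsSplitMono (toShift c V)

/-- The functor `D_c` preserves a retraction of `V ⟶ Σ_b V`, and `D_c Σ_b V ≅ Σ_b D_c V`. -/
lemma ShiftSplit.deriv {V : FIMod k m} (hV : ShiftSplit V) (c : Fin m) :
    ShiftSplit ((deriv c).obj V) := fun b => by
  have := hV b
  rw [← deriv_map_toShift]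
  infer_instance

lemma ShiftSplit.torsionFree {V : FIMod k m} (hV : ShiftSplit V) (c : Fin m) :
    TorsionFree c V := fun n => by
  have := hV c
  refine Function.LeftInverse.injective (g := (retraction (toShift c V)).app n) fun x => ?_
  have h := congrArg (fun α => α.app n x) (IsSplitMono.id (toShift c V))
  exact h

lemma ShiftSplit.derivTorsionFree {V : FIMod k m} (hV : ShiftSplit V) :
    DerivTorsionFree V := fun w c => by
  induction w generalizing V with
  | nil => exact hV.torsionFree c
  | cons b w ih => exact ih (hV.deriv b)

lemma ShiftSplit.of_retract {V W : FIMod k m} (hW : ShiftSplit W) (i : V ⟶ W) (r : W ⟶ V)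
    (h : i ≫ r = 𝟙 V) : ShiftSplit V := fun c => by
  have := hW c
  refine ⟨⟨(shift k c).map i ≫ retraction (toShift c W) ≫ r, ?_⟩⟩
  rw [← Category.assoc, toShift_naturality, Category.assoc, IsSplitMono.id_assoc, h]

lemma ShiftSplit.sigma {J : Type u} (F : J → FIMod k m) (hF : ∀ j, ShiftSplit (F j)) :
    ShiftSplit (∐ F) := fun c => by
  have := fun j => hF j c
  have : PreservesColimit (Discrete.functor F) (shift k c) := by
    unfold shift
    infer_instance
  let hc := isColimitOfPreserves (shift k c) (colimit.isColimit (Discrete.functor F))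
  let s : Cocone (Discrete.functor F ⋙ shift k c) :=
    { pt := ∐ F
      ι := Discrete.natTrans fun j => retraction (toShift c (F j.as)) ≫ Sigma.ι F j.as }
  refine ⟨⟨hc.desc s, Sigma.hom_ext _ _ fun j => ?_⟩⟩
  have h : (shift k c).map (Sigma.ι F j) ≫ hc.desc s =
      retraction (toShift c (F j)) ≫ Sigma.ι F j := hc.fac s ⟨j⟩
  rw [← Category.assoc, ← toShift_naturality, Category.assoc, h, IsSplitMono.id_assoc,
    Category.comp_id]

open Classical in
/-- The element of `M(n)_a` given by a morphism `n ⟶ a + e_c` if the latter factors through `a`,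
and zero otherwise. -/
noncomputable def restrictBasis (c : Fin m) {n a : FIPow m} (f : n ⟶ (iotaAt c).obj a) :
    (n ⟶ a) →₀ k :=
  if h : ∃ g, g ≫ incl c a = f then Finsupp.single h.choose 1 else 0

lemma restrictBasis_comp_incl (c : Fin m) {n a : FIPow m} (g : n ⟶ a) :
    restrictBasis c (g ≫ incl c a) = Finsupp.single g (1 : k) := by
  have h : ∃ g', g' ≫ incl c a = g ≫ incl c a := ⟨g, rfl⟩
  rw [restrictBasis, dif_pos h, incl_cancel c h.choose_spec]

lemma restrictBasis_comp_map (c : Fin m) {n a b : FIPow m} (f : n ⟶ (iotaAt c).obj a)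
    (g : a ⟶ b) : restrictBasis c (f ≫ (iotaAt c).map g) =
      Finsupp.mapDomain (· ≫ g) (restrictBasis c f : (n ⟶ a) →₀ k) := by
  by_cases h : ∃ f', f' ≫ incl c a = f
  · obtain ⟨f, rfl⟩ := h
    rw [Category.assoc, ← incl_naturality, ← Category.assoc, restrictBasis_comp_incl,
      restrictBasis_comp_incl, Finsupp.mapDomain_single]
  · have h' : ¬∃ f', f' ≫ incl c b = f ≫ (iotaAt c).map g := fun ⟨f', hf'⟩ =>
      h (incl_cartesian c f g f' hf')
    rw [restrictBasis, dif_neg h', restrictBasis, dif_neg h, Finsupp.mapDomain_zero]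

/-- The retraction `Σ_c M(n) ⟶ M(n)` that annihilates the morphisms which hit the adjoined
point. -/
noncomputable def principalRetraction (c : Fin m) (n : FIPow m) :
    (shift k c).obj (principalProjective k n) ⟶ principalProjective k n where
  app a := ModuleCat.ofHom
    (Finsupp.linearCombination k fun f : n ⟶ (iotaAt c).obj a => restrictBasis c f)
  naturality a b g := by
    ext : 1
    refine Finsupp.lhom_ext' fun f => LinearMap.ext_ring ?_
    change Finsupp.linearCombination k (fun f : n ⟶ (iotaAt c).obj b => restrictBasis c f)
      (Finsupp.mapDomain (· ≫ (iotaAt c).map g) (Finsupp.single f 1)) =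
      Finsupp.mapDomain (· ≫ g) (Finsupp.linearCombination k
        (fun f : n ⟶ (iotaAt c).obj a => restrictBasis c f) (Finsupp.single f 1))
    rw [Finsupp.mapDomain_single, Finsupp.linearCombination_single,
      Finsupp.linearCombination_single, one_smul, one_smul, restrictBasis_comp_map]

lemma shiftSplit_principalProjective (n : FIPow m) : ShiftSplit (principalProjective k n) :=
  fun c => by
    refine ⟨⟨principalRetraction c n, principal_hom_ext _ _ ?_⟩⟩
    change Finsupp.linearCombination k (fun f : n ⟶ (iotaAt c).obj n => restrictBasis c f)
      (Finsupp.mapDomain (· ≫ incl c n) (Finsupp.single (𝟙 n) 1)) = Finsupp.single (𝟙 n) 1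
    rw [Finsupp.mapDomain_single, Finsupp.linearCombination_single, one_smul,
      restrictBasis_comp_incl]

lemma IsFree.shiftSplit {P : FIMod k m} (hP : IsFree P) : ShiftSplit P := by
  obtain ⟨J, n, ⟨e⟩⟩ := hP
  exact (ShiftSplit.sigma _ fun j => shiftSplit_principalProjective (n j)).of_retract e.hom e.inv
    e.hom_inv_id

/-- A projective module is a direct summand of a free one. -/
lemma shiftSplit_of_projective (P : FIMod k m) [Projective P] : ShiftSplit P := by
  let π : (∐ fun x : (Σ n : FIPow m, P.obj n) => principalProjective k x.1) ⟶ P :=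
    Sigma.desc fun x => fromPrincipal P x.1 x.2
  have hπ : Epi π := by
    rw [NatTrans.epi_iff_epi_app]
    intro n
    rw [ModuleCat.epi_iff_surjective]
    intro v
    refine ⟨(Sigma.ι (fun x : (Σ n : FIPow m, P.obj n) => principalProjective k x.1)
      ⟨n, v⟩).app n (basisElt (𝟙 n)), ?_⟩
    rw [← ModuleCat.comp_apply, ← NatTrans.comp_app, Sigma.ι_desc]
    exact fromPrincipal_apply P n v
  exact (ShiftSplit.sigma _ fun x : (Σ n : FIPow m, P.obj n) =>
    shiftSplit_principalProjective x.1).of_retract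
    (Projective.factorThru (𝟙 P) π) π (Projective.factorThru_comp _ _)

/-! ### Torsion of presented modules and of their shifts -/

/-- A presentation of `V` with generators in degrees `< p` and relations in degrees `< q`, where
the module of generators is a direct summand of its shifts. -/
def Presented (p q : ℕ) (V : FIMod k m) : Prop :=
  ∃ (U P : FIMod k m) (f : U ⟶ P) (h : P ⟶ V),
    SES f h ∧ ShiftSplit P ∧ GeneratedBelow p P ∧ GeneratedBelow q U

lemma Presented.deriv {p q : ℕ} {V : FIMod k m} (hV : Presented p q V) (c : Fin m) :
    Presented p q ((deriv c).obj V) := by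
  obtain ⟨U, P, f, h, hs, hP, hp, hq⟩ := hV
  have hex := hs.toRightExact.deriv c
  exact ⟨_, _, _, _, ker.ses _ hex.surj, hP.deriv c, hp.deriv c,
    (hq.deriv c).of_surjective (ker.lift_surjective hex)⟩

/-- At all `n` with `n_j ≥ t_j`, all iterated derivatives of `V` are torsion free. -/
def DerivTorsionFreeFrom (t : Fin m → ℕ) (V : FIMod k m) : Prop :=
  ∀ w c n, (∀ j, t j ≤ (n j).card) → Function.Injective ((derivList w V).map (incl c n))

lemma Presented.derivTorsionFreeFrom {p q s : ℕ} {V : FIMod k m} (hV : Presented p q V)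
    (hs : p + q ≤ s + 2) : DerivTorsionFreeFrom (fun _ => s) V := by
  intro w c n hn
  induction w generalizing V with
  | nil =>
    obtain ⟨U, P, f, h, hses, hP, hp, hq⟩ := hV
    exact (torsion_bound p q hses (fun j => hP.derivTorsionFree _ c) (hp.null_derivIter c)
      (hq.null_derivIter c)).2 s hs n (hn c)
  | cons b w ih => exact ih (hV.deriv b)

lemma derivList_shift (b : Fin m) (w : List (Fin m)) {V W : FIMod k m}
    (e : W ≅ (shift k b).obj V) : Nonempty (derivList w W ≅ (shift k b).obj (derivList w V)) := by
  induction w generalizing V W with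
  | nil => exact ⟨e⟩
  | cons c w ih => exact ih ((deriv c).mapIso e ≪≫ asIso (derivShift c b V))

lemma DerivTorsionFreeFrom.shift {t t' : Fin m → ℕ} {V : FIMod k m}
    (hV : DerivTorsionFreeFrom t V) (b : Fin m)
    (ht : ∀ j, t j ≤ t' j + (Pi.single b 1 : Fin m → ℕ) j) :
    DerivTorsionFreeFrom t' ((shift k b).obj V) := by
  intro w c n hn
  obtain ⟨e⟩ := derivList_shift b w (Iso.refl ((FIModule.shift k b).obj V))
  refine injective_map fun x hx => ?_
  let y : (derivList w V).obj ((iotaAt b).obj n) := e.hom.app n x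
  have h₁ : (derivList w V).map ((iotaAt b).map (incl c n)) y = 0 := by
    have := app_map e.hom (incl c n) x
    rw [hx, map_zero] at this
    exact this.symm
  rw [← incl_braid, ← map_map] at h₁
  have h₂ := map_braid_injective (derivList w V) b c n (h₁.trans (map_zero _).symm)
  have h₃ := hV w c _ (fun j => by
    rw [iotaAt_obj_card]
    exact (ht j).trans (Nat.add_le_add_right (hn j) _)) (h₂.trans (map_zero _).symm)
  have h₄ := congrArg (fun α => α.app n x) e.hom_inv_id
  exact h₄.symm.trans ((congrArg (e.inv.app n) h₃).trans (map_zero _))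

lemma DerivTorsionFreeFrom.shift_iterate {s : ℕ} {t t' : Fin m → ℕ} {V : FIMod k m}
    (hV : DerivTorsionFreeFrom t V) (b : Fin m)
    (ht : ∀ j, t j ≤ t' j + (Pi.single b s : Fin m → ℕ) j) :
    DerivTorsionFreeFrom t' ((FIModule.shift k b).obj^[s] V) := by
  induction s generalizing t' with
  | zero =>
    intro w c n hn
    refine hV w c n fun j => (ht j).trans ?_
    simpa using hn j
  | succ s ih =>
    rw [Function.iterate_succ_apply']
    refine (ih (t' := fun j => t' j + (Pi.single b 1 : Fin m → ℕ) j) fun j => ?_).shift b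
      fun j => le_rfl
    refine (ht j).trans ?_
    by_cases hj : j = b
    · subst hj
      simp only [Pi.single_eq_same]
      omega
    · simp [Pi.single_eq_of_ne hj]

lemma DerivTorsionFreeFrom.multiShift {s : ℕ} {V : FIMod k m}
    (hV : DerivTorsionFreeFrom (fun _ => s) V) : DerivTorsionFree (multiShift s V) := by
  have key : ∀ l : List (Fin m), DerivTorsionFreeFrom (fun j => if j ∈ l then 0 else s)
      (l.foldr (fun i W => (FIModule.shift k i).obj^[s] W) V) := by
    intro l
    induction l with
    | nil => simpa using hV
    | cons b l ih =>
      refine ih.shift_iterate b fun j => ?_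
      by_cases hj : j = b
      · subst hj
        simp only [Pi.single_eq_same]
        split_ifs <;> omega
      · simp [hj]
  intro w c n
  exact key _ w c n fun j => by simp

/-! ### Vanishing of homology -/

lemma H0_map_injective {A B C : FIMod k m} {f : A ⟶ B} {g : B ⟶ C} (h : SES f g)
    (hC : DerivTorsionFree C) (n : FIPow m) : Function.Injective (((H0 k m).map f).app n) := by
  refine injective_app fun x hx => ?_
  obtain ⟨x, rfl⟩ := Submodule.mkQ_surjective (decomposable A n) x
  exact (Submodule.Quotient.mk_eq_zero _).2 (mem_decomposable_of_injective f
    (fun w => (h.derivList w hC).inj) n x ((Submodule.Quotient.mk_eq_zero _).1 hx))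

lemma H0_map_surjective {B C : FIMod k m} {g : B ⟶ C} (hg : ∀ n, Function.Surjective (g.app n))
    (n : FIPow m) : Function.Surjective (((H0 k m).map g).app n) := by
  intro x
  obtain ⟨x, rfl⟩ := Submodule.mkQ_surjective (decomposable C n) x
  obtain ⟨y, rfl⟩ := hg n x
  exact ⟨Submodule.Quotient.mk y, rfl⟩

lemma RightExact.H0 {A B C : FIMod k m} {f : A ⟶ B} {g : B ⟶ C} (h : RightExact f g) :
    RightExact ((H0 k m).map f) ((H0 k m).map g) where
  surj := H0_map_surjective h.surj
  comp_eq_zero n x := by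
    obtain ⟨x, rfl⟩ := Submodule.mkQ_surjective (decomposable A n) x
    change Submodule.Quotient.mk (g.app n (f.app n x)) = (0 : C.obj n ⧸ decomposable C n)
    rw [h.comp_eq_zero, Submodule.Quotient.mk_zero]
  exact n y hy := by
    obtain ⟨y, rfl⟩ := Submodule.mkQ_surjective (decomposable B n) y
    have hle : decomposable C n ≤ (decomposable B n).map (g.app n).hom := by
      refine Submodule.span_le.2 ?_
      rintro _ ⟨a, ha, φ, v, rfl⟩
      obtain ⟨v, rfl⟩ := h.surj a v
      exact ⟨B.map φ v, Submodule.subset_span ⟨a, ha, φ, v, rfl⟩, app_map g φ v⟩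
    obtain ⟨z, hz, hzy⟩ := hle ((Submodule.Quotient.mk_eq_zero _).1 hy)
    obtain ⟨x, hx⟩ := h.exact n (y - z) (by
      rw [map_sub, sub_eq_zero]
      exact hzy.symm)
    refine ⟨Submodule.Quotient.mk x, ?_⟩
    change Submodule.Quotient.mk (f.app n x) = (Submodule.Quotient.mk y : _ ⧸ decomposable B n)
    rw [hx, Submodule.Quotient.eq, sub_sub_cancel_left]
    exact neg_mem hz

/-- Exactness of a short complex of `FI^m`-modules, on elements. -/
lemma exact_app {S : ShortComplex (FIMod k m)} (hS : S.Exact) (n : FIPow m) (x : S.X₂.obj n)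
    (hx : S.g.app n x = 0) : ∃ y, S.f.app n y = x :=
  (ShortComplex.moduleCat_exact_iff _).1 (hS.map ((evaluation _ _).obj n)) x hx

lemma exact_of_app {S : ShortComplex (FIMod k m)}
    (h : ∀ n (x : S.X₂.obj n), S.g.app n x = 0 → ∃ y, S.f.app n y = x) : S.Exact := by
  rw [ShortComplex.exact_iff_isZero_homology, Functor.isZero_iff]
  intro n
  refine IsZero.of_iso ?_ (S.mapHomologyIso ((evaluation _ _).obj n)).symm
  rw [← ShortComplex.exact_iff_isZero_homology, ShortComplex.moduleCat_exact_iff]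
  exact h n

lemma surjective_app_of_epi {V W : FIMod k m} (f : V ⟶ W) [Epi f] (n : FIPow m) :
    Function.Surjective (f.app n) :=
  (ModuleCat.epi_iff_surjective _).1 inferInstance

/-- If `A ⟶ B ⟶ C ⟶ E ⟶ 0` is exact and `E` and all its iterated derivatives are torsion free, then
`H_0` preserves the exactness at `B`. -/
lemma H0_exact {A B C E : FIMod k m} {f : A ⟶ B} {g : B ⟶ C} {h : C ⟶ E}
    (hh : ∀ n, Function.Surjective (h.app n)) (hE : DerivTorsionFree E)
    (hfg : ∀ n x, g.app n (f.app n x) = 0) (hgh : ∀ n x, h.app n (g.app n x) = 0)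
    (hB : ∀ n x, g.app n x = 0 → ∃ y, f.app n y = x)
    (hC : ∀ n x, h.app n x = 0 → ∃ y, g.app n y = x) (n : FIPow m) (x : ((H0 k m).obj B).obj n)
    (hx : ((H0 k m).map g).app n x = 0) : ∃ y, ((H0 k m).map f).app n y = x := by
  let ℓ := ker.lift h g hgh
  have hℓ : RightExact f ℓ :=
    { surj := by
        rintro n ⟨y, hy⟩
        obtain ⟨x, hx⟩ := hC n y hy
        exact ⟨x, Subtype.ext hx⟩
      comp_eq_zero := fun n x => Subtype.ext (hfg n x)
      exact := fun n y hy => hB n y (congrArg Subtype.val hy) }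
  refine hℓ.H0.exact n x (H0_map_injective (ker.ses h hh) hE n ?_)
  rw [map_zero, ← hx]
  have : ℓ ≫ ker.ι h = g := rfl
  rw [← this, Functor.map_comp]
  rfl

/-- If `V` and all its iterated derivatives are torsion free, then the same holds for the syzygies
in a projective resolution of `V`, and `H_0` maps this resolution to an exact complex. -/
theorem homologyAcyclic_of_derivTorsionFree {V : FIMod k m} (hV : DerivTorsionFree V) :
    HomologyAcyclic V := by
  intro i hi
  obtain ⟨i, rfl⟩ := Nat.exists_eq_add_of_le' hi
  let P := ProjectiveResolution.of V
  have hP : ∀ i, DerivTorsionFree (P.complex.X i) := fun i =>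
    (shiftSplit_of_projective _).derivTorsionFree
  have hd : ∀ i n x, (P.complex.d (i + 1) i).app n ((P.complex.d (i + 2) (i + 1)).app n x) = 0 :=
    fun i n x => congrArg (fun α => α.app n x) (P.complex.d_comp_d (i + 2) (i + 1) i)
  have hd' := fun i n => exact_app (P.exact_succ i) n
  have hπ : ∀ n x, (P.π.f 0).app n ((P.complex.d 1 0).app n x) = 0 :=
    fun n x => congrArg (fun α => α.app n x) P.complex_d_comp_π_f_zero
  have hepi : Epi (P.π.f 0) := inferInstance
  have hπ' := fun n => exact_app P.exact₀ n
  -- The syzygies `E` of the resolution have torsion free derivatives.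
  have syz : ∀ i, ∃ (E : FIMod k m) (h : P.complex.X i ⟶ E), DerivTorsionFree E ∧
      (∀ n, Function.Surjective (h.app n)) ∧
      (∀ n x, h.app n ((P.complex.d (i + 1) i).app n x) = 0) ∧
      ∀ n x, h.app n x = 0 → ∃ y, (P.complex.d (i + 1) i).app n y = x := by
    intro i
    induction i with
    | zero => exact ⟨V, P.π.f 0, hV, fun n => @surjective_app_of_epi _ _ _ _ _ _ hepi n, hπ, hπ'⟩
    | succ i ih =>
      obtain ⟨E, h, hE, hh, h₁, h₂⟩ := ih
      refine ⟨ker h, ker.lift h _ h₁, (ker.ses h hh).derivTorsionFree (hP i) hE, ?_,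
        fun n x => Subtype.ext (hd i n x), fun n x hx => hd' i n x (congrArg Subtype.val hx)⟩
      rintro n ⟨y, hy⟩
      obtain ⟨x, hx⟩ := h₂ n y hy
      exact ⟨x, Subtype.ext hx⟩
  obtain ⟨E, h, hE, hh, h₁, h₂⟩ := syz i
  refine IsZero.of_iso ?_ (P.isoLeftDerivedObj (H0 k m) (i + 1))
  change IsZero ((((H0 k m).mapHomologicalComplex _).obj P.complex).homology (i + 1))
  rw [← HomologicalComplex.exactAt_iff_isZero_homology,
    HomologicalComplex.exactAt_iff' _ (i + 2) (i + 1) i (by simp) (by simp)]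
  exact exact_of_app fun n x hx => H0_exact hh hE (hd i) h₁ (hd' i) h₂ n x hx

lemma GeneratedInDegree.generatedBelow {V : FIMod k m} {d : ℤ} (h : GeneratedInDegree V d) :
    GeneratedBelow (d + 1).toNat V := by
  intro n hn
  have h' := ((degree_le_iff _ _).1 h).2 n
  by_contra hne
  have : Nontrivial (((H0 k m).obj V).obj n) := Submodule.Quotient.nontrivial_iff.2 hne
  have := h' this
  omega

lemma ses_of_shortExact {S : ShortComplex (FIMod k m)} (hS : S.ShortExact) : SES S.f S.g where
  surj := by
    have := hS.epi_g
    exact surjective_app_of_epi _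
  comp_eq_zero n x := congrArg (fun α => α.app n x) S.zero
  exact n := exact_app hS.exact n
  inj n := by
    have := hS.mono_f
    exact (ModuleCat.mono_iff_injective _).1 inferInstance

lemma GeneratedRelatedInDegree.presented {V : FIMod k m} {d r : ℤ}
    (h : GeneratedRelatedInDegree V d r) : Presented (d + 1).toNat (r + 1).toNat V := by
  obtain ⟨U, P, f, g, w, hs, hP, hd, hr⟩ := h
  exact ⟨U, P, f, g, ses_of_shortExact hs, hP.shiftSplit, hd.generatedBelow, hr.generatedBelow⟩

end FIModule

theorem theorem3p3 {k : Type u} [CommRing k] (m : ℕ) (hm : 1 ≤ m) (d r : ℤ) (hd : -1 ≤ d)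
    (hr : -1 ≤ r) (V : FIModule.FIMod k m) (hV : FIModule.GeneratedRelatedInDegree V d r)
    (s : ℕ) (hs : d + r ≤ (s : ℤ)) :
    FIModule.HomologyAcyclic (FIModule.multiShift s V) :=
  FIModule.homologyAcyclic_of_derivTorsionFree
    (hV.presented.derivTorsionFreeFrom (by omega)).multiShift
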